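/- Let $A$ be an associative ring with unit; modules are left $A$-modules. A module $T$ is \emph{classical $n$-tilting} ($n\ge 0$) if: ($p_n$) there is an exact sequence $0\to P_n\to\cdots\to P_0\to T\to 0$ with all $P_i$ finitely generated projective; ($e_n$) $\operatorname{Ext}^i_A(T,T)=0$ for $0<i\le n$; ($g_n$) there is an exact sequence $0\to A\to T_0\to\cdots\to T_n\to 0$ in which every $T_i$ is finitely generated and a direct summand of a (possibly infinite) coproduct of copies of $T$. In the derived category $\mathcal D(A)$ of $A\text{-Mod}$ put $$\mathcal T^{\le 0}=\{Y:\operatorname{Hom}_{\mathcal D(A)}(T,Y[i])=0\text{ for all }i>0\},\qquad \mathcal T^{\le e}=\mathcal T^{\le 0}[-e],$$ and identify a module with the corresponding complex concentrated in degree $0$. **Lemma.** Let $T$ be a classical $n$-tilting module and let $0\le e\le n$. 1. If $X$ is a module with $\operatorname{Ext}^i_A(T,X)=0$ for all $i>e$, then there is a complex $$\cdots\to T_{-1}\to T_0\to\cdots\to T_e\to 0$$ (with $T_i$ in degree $i$) whose terms are direct summands of coproducts of copies of $T$, which is exact everywhere except in degree $0$, and whose cohomology in degree $0$ is isomorphic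 to $X$. (For $e=0$ this is Bazzoni's lemma: $X$ has a resolution $\cdots\to T_{-1}\to T_0\to X\to 0$ of this kind.) 2. Conversely, if there is such a complex for $X$, then $\operatorname{Ext}^i_A(T,X)=0$ for all $i>e$. 3. In particular, for $e=n$: every module $X$ satisfies $\operatorname{Ext}^i_A(T,X)=0$ for all $i>n$, and hence admits such a complex with $e=n$. 4. $\bigcap_{i>e}\operatorname{Ker}\operatorname{Ext}^i_A(T,?)=A\text{-Mod}\cap\mathcal T^{\le e}$. -/

import Mathlib

open CategoryTheory CategoryTheory.Limits

universe u w

/-- `Add T`: the left `A`-modules `M` which are direct summands of a coproduct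
`T^(ι)` of copies of `T`, over an arbitrary index set `ι`. -/
def IsSummandOfCoproduct {A : Type u} [Ring A] (T M : ModuleCat.{u} A) : Prop :=
  ∃ (ι : Type u) (N : ModuleCat.{u} A), Nonempty ((M × N) ≃ₗ[A] (ι →₀ T))

/-- A classical `n`-tilting left `A`-module. -/
structure IsClassicalTilting {A : Type u} [Ring A] (n : ℕ) (T : ModuleCat.{u} A) : Prop where
  /-- There is an exact sequence `0 → P_n → ⋯ → P_0 → T → 0` with all `P_i` finitely generated
  and projective. -/
  finite_projective_resolution :
    ∃ P : ProjectiveResolution T,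
      (∀ i, Module.Finite A (P.complex.X i)) ∧ ∀ i, n < i → IsZero (P.complex.X i)
  /-- `Ext^i(T, T) = 0` for `0 < i ≤ n`. -/
  rigid : ∀ i : ℕ, 0 < i → i ≤ n → Subsingleton (Abelian.Ext T T i)
  /-- There is an exact sequence `0 → A → T_0 → ⋯ → T_n → 0` with all `T_i` finitely generated
  and in `Add T`; exactness says that the augmentation from `A`, seen as a complex concentrated in
  degree `0`, is a quasi-isomorphism. -/
  coresolution :
    ∃ (C : CochainComplex (ModuleCat.{u} A) ℕ)
      (ε : (CochainComplex.single₀ (ModuleCat.{u} A)).obj (ModuleCat.of A A) ⟶ C),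
      QuasiIso ε ∧
      (∀ i, Module.Finite A (C.X i) ∧ IsSummandOfCoproduct T (C.X i)) ∧
      ∀ i, n < i → IsZero (C.X i)

/-- The class `⋂_{i > e} Ker Ext^i_A(T, ?)` of left `A`-modules. -/
def kerExtAbove {A : Type u} [Ring A] (T : ModuleCat.{u} A) (e : ℕ) :
    ObjectProperty (ModuleCat.{u} A) :=
  fun X => ∀ i : ℕ, e < i → Subsingleton (Abelian.Ext T X i)

/-- `X` is the cohomology of a complex `⋯ → T_{-1} → T_0 → ⋯ → T_e → 0` whose terms are in
`Add T` and which is exact everywhere except in degree `0`. -/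
def HasAddComplex {A : Type u} [Ring A] (T : ModuleCat.{u} A) (e : ℕ) (X : ModuleCat.{u} A) :
    Prop :=
  ∃ K : CochainComplex (ModuleCat.{u} A) ℤ,
    (∀ i : ℤ, IsSummandOfCoproduct T (K.X i)) ∧
    (∀ i : ℤ, (e : ℤ) < i → IsZero (K.X i)) ∧
    (∀ i : ℤ, i ≠ 0 → K.ExactAt i) ∧
    Nonempty (K.homology 0 ≅ X)

/-- The class `𝒯^{≤ 0}` of the objects `Y` of the derived category `D(A)` such that
`Hom_{D(A)}(T, Y[i]) = 0` for all `i > 0`. -/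
def tiltingAisle {A : Type u} [Ring A] [HasDerivedCategory.{w} (ModuleCat.{u} A)]
    (T : ModuleCat.{u} A) : ObjectProperty (DerivedCategory (ModuleCat.{u} A)) :=
  fun Y => ∀ i : ℤ, 0 < i →
    ∀ f : (DerivedCategory.singleFunctor (ModuleCat.{u} A) 0).obj T ⟶ Y⟦i⟧, f = 0

/-- `𝒯^{≤ m} = 𝒯^{≤ 0}[-m]`: the objects `Y` of `D(A)` such that `Y[m]` is in `𝒯^{≤ 0}`. -/
def tiltingAisleLE {A : Type u} [Ring A] [HasDerivedCategory.{w} (ModuleCat.{u} A)]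
    (T : ModuleCat.{u} A) (m : ℤ) : ObjectProperty (DerivedCategory (ModuleCat.{u} A)) :=
  fun Y => tiltingAisle T (Y⟦m⟧)

/-! Call a module acyclic if `Ext^i(T, ?)` vanishes on it for all `i > 0`. Finite generation of the
projectives resolving `T` spreads rigidity from `T` to all of `Add T`. The coresolution of `A` makes
every acyclic `X` generated by `T`, so the evaluation `T^(Hom(T, X)) → X` is onto. Its kernel is
again acyclic, because every map `T → X` lifts. Iterating gives Bazzoni's resolution, the case `e =
0`.

For larger `e`, induct. Embed `X` in an injective `I` and take `0 → I/X → M_0 → M_1 → ⋯` with `M_0`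
acyclic and the later terms in `Add T`. Pull back `I → M_0` along the evaluation `F → M_0`. The
pullback `Y` is an extension of `I` by an acyclic module, hence acyclic, and `0 → X → Y → F → M_1 →
⋯` is exact. Splicing in the `Add T`-resolution of `Y` leaves `X` as the only cohomology.

The converse is dimension shifting along the cocycle modules: to the right they vanish beyond degree
`e`, and to the left the shift stops because `T` has projective dimension at most `n`. The
description by `𝒯^{≤ e}` is the identification of `Ext` with shifted morphisms in `D(A)`. -/

open CategoryTheory.Abelian

/-! ### Vanishing of `Ext` along long exact sequences -/

section LongExactSequence

universe v v'

variable {C : Type v} [Category.{v'} C] [Abelian C] [HasExt.{w} C] {S : ShortComplex C}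

theorem subsingleton_ext_middle (hS : S.ShortExact) (X : C) (i : ℕ)
    (h₁ : Subsingleton (Ext X S.X₁ i)) (h₃ : Subsingleton (Ext X S.X₃ i)) :
    Subsingleton (Ext X S.X₂ i) := by
  refine subsingleton_of_forall_eq 0 fun x => ?_
  obtain ⟨y, rfl⟩ := Ext.covariant_sequence_exact₂ X hS x (Subsingleton.elim _ _)
  rw [Subsingleton.elim y 0, Ext.zero_comp]

theorem subsingleton_ext_right (hS : S.ShortExact) (X : C) (i : ℕ)
    (h₂ : Subsingleton (Ext X S.X₂ i)) (h₁ : Subsingleton (Ext X S.X₁ (i + 1))) :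
    Subsingleton (Ext X S.X₃ i) := by
  refine subsingleton_of_forall_eq 0 fun x => ?_
  obtain ⟨y, rfl⟩ := Ext.covariant_sequence_exact₃ X hS x rfl (Subsingleton.elim _ _)
  rw [Subsingleton.elim y 0, Ext.zero_comp]

theorem subsingleton_ext_left (hS : S.ShortExact) (X : C) (i : ℕ)
    (h₃ : Subsingleton (Ext X S.X₃ i)) (h₂ : Subsingleton (Ext X S.X₂ (i + 1))) :
    Subsingleton (Ext X S.X₁ (i + 1)) := by
  refine subsingleton_of_forall_eq 0 fun x => ?_
  obtain ⟨y, rfl⟩ := Ext.covariant_sequence_exact₁ X hS x (Subsingleton.elim _ _) rfl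
  rw [Subsingleton.elim y 0, Ext.zero_comp]

/-- If every map to the quotient lifts, the connecting map out of `Hom(X, S.X₃)` is zero. This is
the degree-one step where `Ext^0(X, S.X₃)` need not vanish. -/
theorem subsingleton_ext_one_left (hS : S.ShortExact) (X : C)
    (hlift : ∀ f : X ⟶ S.X₃, ∃ g : X ⟶ S.X₂, g ≫ S.g = f)
    (h₂ : Subsingleton (Ext X S.X₂ 1)) : Subsingleton (Ext X S.X₁ 1) := by
  refine subsingleton_of_forall_eq 0 fun x => ?_
  obtain ⟨y, rfl⟩ := Ext.covariant_sequence_exact₁ X hS x (Subsingleton.elim _ _)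
    (show 0 + 1 = 1 from rfl)
  obtain ⟨f, rfl⟩ := (Ext.mk₀_bijective _ _).2 y
  obtain ⟨g, rfl⟩ := hlift f
  rw [← Ext.mk₀_comp_mk₀, Ext.comp_assoc_of_second_deg_zero, hS.comp_extClass, Ext.comp_zero]

theorem subsingleton_ext_of_contravariant_left (hS : S.ShortExact) (Y : C) (i : ℕ)
    (h₂ : Subsingleton (Ext S.X₂ Y i)) (h₃ : Subsingleton (Ext S.X₃ Y (i + 1))) :
    Subsingleton (Ext S.X₁ Y i) := by
  refine subsingleton_of_forall_eq 0 fun x => ?_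
  obtain ⟨y, rfl⟩ := Ext.contravariant_sequence_exact₁ hS Y x (add_comm 1 i)
    (Subsingleton.elim _ _)
  rw [Subsingleton.elim y 0, Ext.comp_zero]

theorem exists_extension_of_subsingleton_ext (hS : S.ShortExact) (Y : C)
    (h₃ : Subsingleton (Ext S.X₃ Y 1)) (f : S.X₁ ⟶ Y) : ∃ g : S.X₂ ⟶ Y, S.f ≫ g = f := by
  obtain ⟨y, hy⟩ := Ext.contravariant_sequence_exact₁ hS Y (Ext.mk₀ f) (add_zero 1)
    (Subsingleton.elim _ _)
  obtain ⟨g, rfl⟩ := (Ext.mk₀_bijective _ _).2 y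
  exact ⟨g, (Ext.mk₀_bijective _ _).1 (by rw [← hy, Ext.mk₀_comp_mk₀])⟩

theorem subsingleton_ext_of_isZero_right {Y : C} (hY : IsZero Y) (X : C) (i : ℕ) :
    Subsingleton (Ext X Y i) := by
  refine subsingleton_of_forall_eq 0 fun x => ?_
  rw [← x.comp_mk₀_id, hY.eq_of_src (𝟙 Y) 0, Ext.mk₀_zero, Ext.comp_zero]

theorem subsingleton_ext_of_isZero_left {X : C} (hX : IsZero X) (Y : C) (i : ℕ) :
    Subsingleton (Ext X Y i) := by
  refine subsingleton_of_forall_eq 0 fun x => ?_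
  rw [← x.mk₀_id_comp, hX.eq_of_src (𝟙 X) 0, Ext.mk₀_zero, Ext.zero_comp]

theorem subsingleton_ext_of_iso {Y Z : C} (e : Y ≅ Z) (X : C) (i : ℕ)
    (h : Subsingleton (Ext X Y i)) : Subsingleton (Ext X Z i) := by
  refine subsingleton_of_forall_eq 0 fun x => ?_
  rw [← x.comp_mk₀_id, ← e.inv_hom_id, ← Ext.mk₀_comp_mk₀, ← Ext.comp_assoc_of_third_deg_zero,
    Subsingleton.elim (x.comp _ _) 0, Ext.zero_comp]

/-- `Ext^i(X, Y)` vanishes if and only if all cocycles of degree `i` on a projective resolution of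
`X` are coboundaries. -/
theorem subsingleton_ext_succ_iff {X : C} (P : ProjectiveResolution X) (Y : C) (i : ℕ) :
    Subsingleton (Ext X Y (i + 1)) ↔ ∀ f : P.complex.X (i + 1) ⟶ Y,
      P.complex.d (i + 2) (i + 1) ≫ f = 0 → ∃ g, P.complex.d (i + 1) i ≫ g = f := by
  constructor
  · intro h f hf
    exact (P.extMk_eq_zero_iff f (i + 2) rfl hf i rfl).1 (Subsingleton.elim _ _)
  · intro h
    refine subsingleton_of_forall_eq 0 fun x => ?_
    obtain ⟨f, hf, rfl⟩ := P.extMk_surjective x (i + 2) rfl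
    exact (P.extMk_eq_zero_iff f (i + 2) rfl hf i rfl).2 (h f hf)

theorem subsingleton_ext_of_isZero_resolution {X : C} (P : ProjectiveResolution X) (Y : C) {i : ℕ}
    (hi : IsZero (P.complex.X i)) : Subsingleton (Ext X Y i) := by
  refine subsingleton_of_forall_eq 0 fun x => ?_
  obtain ⟨f, hf, rfl⟩ := P.extMk_surjective x (i + 1) rfl
  obtain rfl := hi.eq_of_src f 0
  exact P.extMk_zero _ _

end LongExactSequence

/-! ### `Add T` and finitely generated modules -/

section Modules

variable {A : Type u} [Ring A]

theorem IsSummandOfCoproduct.exists_retract {T M : ModuleCat.{u} A}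
    (hM : IsSummandOfCoproduct T M) :
    ∃ (ι : Type u) (s : M →ₗ[A] (ι →₀ T)) (r : (ι →₀ T) →ₗ[A] M), ∀ x, r (s x) = x := by
  obtain ⟨ι, N, ⟨e⟩⟩ := hM
  exact ⟨ι, e.toLinearMap ∘ₗ LinearMap.inl A M N, LinearMap.fst A M N ∘ₗ e.symm.toLinearMap,
    fun x => by simp⟩

theorem isSummandOfCoproduct_finsupp (T : ModuleCat.{u} A) (ι : Type u) :
    IsSummandOfCoproduct T (ModuleCat.of A (ι →₀ T)) :=
  ⟨ι, ModuleCat.of A PUnit.{u + 1}, ⟨LinearEquiv.prodUnique⟩⟩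

theorem isSummandOfCoproduct_of_isZero (T : ModuleCat.{u} A) {M : ModuleCat.{u} A}
    (hM : IsZero M) : IsSummandOfCoproduct T M := by
  have : Subsingleton M := ModuleCat.subsingleton_of_isZero hM
  exact ⟨PEmpty, ModuleCat.of A PUnit.{u + 1}, ⟨⟨0, 0, fun _ => Subsingleton.elim _ _,
    fun _ => Subsingleton.elim _ _⟩⟩⟩

/-- The finitely many generators of `M` have images with finite supports; the union of these
supports serves for all of `M`. -/
theorem exists_finset_sum_single_eq {M N ι : Type*} [AddCommGroup M] [Module A M]
    [AddCommGroup N] [Module A N] [Module.Finite A M] (f : M →ₗ[A] (ι →₀ N)) :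
    ∃ F : Finset ι, ∀ x, ∑ a ∈ F, Finsupp.single a (f x a) = f x := by
  classical
  obtain ⟨G, hG⟩ := Module.Finite.fg_top (R := A) (M := M)
  let F : Finset ι := G.biUnion fun x => (f x).support
  have hF : (⊤ : Submodule A M) ≤ (Finsupp.supported N A (F : Set ι)).comap f := by
    rw [← hG, Submodule.span_le]
    intro y hy
    refine (Finsupp.mem_supported A _).2 ?_
    exact_mod_cast Finset.subset_biUnion_of_mem (fun x => (f x).support) hy
  refine ⟨F, fun x => ?_⟩
  conv_rhs => rw [← Finsupp.sum_single (f x)]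
  have hx : f x ∈ Finsupp.supported N A (F : Set ι) := hF (Submodule.mem_top (x := x))
  exact (Finsupp.sum_of_support_subset _ (by exact_mod_cast hx) _ (by simp)).symm

/-- If `T` has a resolution by finitely generated projective modules, then the vanishing of
`Ext^i(T, T)` implies the vanishing of `Ext^i(T, M)` for all `M` in `Add T`. -/
theorem subsingleton_ext_of_isSummandOfCoproduct {T M : ModuleCat.{u} A}
    (P : ProjectiveResolution T) (i : ℕ) [Module.Finite A (P.complex.X (i + 1))]
    (h : Subsingleton (Ext T T (i + 1))) (hM : IsSummandOfCoproduct T M) :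
    Subsingleton (Ext T M (i + 1)) := by
  classical
  rw [subsingleton_ext_succ_iff P] at h ⊢
  obtain ⟨ι, s, r, hrs⟩ := hM.exists_retract
  intro f hf
  have hf' : ∀ x, f.hom ((P.complex.d (i + 2) (i + 1)).hom x) = 0 := fun x =>
    congr($(hf).hom x)
  -- The cocycle meets only finitely many copies of `T`, so it can be bounded coordinate by
  -- coordinate and the solutions summed.
  obtain ⟨F, hF⟩ := exists_finset_sum_single_eq (s ∘ₗ f.hom)
  have key : ∀ a : ι, ∃ g : P.complex.X i ⟶ T, P.complex.d (i + 1) i ≫ g =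
      ModuleCat.ofHom (Finsupp.lapply a ∘ₗ s ∘ₗ f.hom) := by
    intro a
    refine h _ ?_
    ext x
    simp [hf' x]
  choose g hg using key
  have hg' : ∀ a x, (g a).hom ((P.complex.d (i + 1) i).hom x) = s (f.hom x) a := fun a x =>
    congr($(hg a).hom x)
  refine ⟨ModuleCat.ofHom (r ∘ₗ ∑ a ∈ F, Finsupp.lsingle a ∘ₗ (g a).hom), ?_⟩
  ext x
  have := hF x
  simp only [LinearMap.comp_apply] at this
  simp [hg', this, hrs]

/-- If `M` is finitely generated and in `Add T`, then the vanishing of `Ext^i(T, X)` implies the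
vanishing of `Ext^i(M, X)`. -/
theorem subsingleton_ext_of_finite_summand {T M : ModuleCat.{u} A} [Module.Finite A M]
    (hM : IsSummandOfCoproduct T M) (X : ModuleCat.{u} A) (i : ℕ)
    (h : Subsingleton (Ext T X i)) : Subsingleton (Ext M X i) := by
  classical
  obtain ⟨ι, s, r, hrs⟩ := hM.exists_retract
  obtain ⟨F, hF⟩ := exists_finset_sum_single_eq s
  -- The identity of `M` is a finite sum of maps `M → T → M`, so each class in `Ext^i(M, X)` is a
  -- sum of classes passing through `Ext^i(T, X) = 0`.
  have hid : 𝟙 M = ∑ a : F, ModuleCat.ofHom (Finsupp.lapply (a : ι) ∘ₗ s) ≫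
      ModuleCat.ofHom (r ∘ₗ Finsupp.lsingle (a : ι)) := by
    ext x
    conv_lhs => rw [ModuleCat.id_apply, ← hrs x, ← hF x, map_sum, ← Finset.sum_coe_sort]
    simp
  refine subsingleton_of_forall_eq 0 fun α => ?_
  rw [← α.mk₀_id_comp, hid, Ext.mk₀_sum, Ext.sum_comp]
  refine Finset.sum_eq_zero fun a _ => ?_
  rw [← Ext.mk₀_comp_mk₀, Ext.comp_assoc_of_second_deg_zero]
  rw [Subsingleton.elim ((Ext.mk₀ (ModuleCat.ofHom (r ∘ₗ Finsupp.lsingle (a : ι)))).comp α _) 0,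
    Ext.comp_zero]

/-- The sequence `0 → Ker f → M → Ker g → 0` attached to `M → N → P`. -/
abbrev kernelSequence {M N P : ModuleCat.{u} A} (f : M ⟶ N) (g : N ⟶ P) (w : f ≫ g = 0) :
    ShortComplex (ModuleCat.{u} A) :=
  ShortComplex.mk (X₁ := ModuleCat.of A (LinearMap.ker f.hom)) (X₂ := M)
    (X₃ := ModuleCat.of A (LinearMap.ker g.hom))
    (ModuleCat.ofHom (LinearMap.ker f.hom).subtype)
    (ModuleCat.ofHom (f.hom.codRestrict (LinearMap.ker g.hom) fun x => congr($(w).hom x)))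
    (ModuleCat.hom_ext (LinearMap.ext fun x => Subtype.ext x.2))

theorem kernelSequence_shortExact {M N P : ModuleCat.{u} A} {f : M ⟶ N} {g : N ⟶ P}
    (w : f ≫ g = 0) (h : Function.Exact f.hom g.hom) : (kernelSequence f g w).ShortExact := by
  refine ModuleCat.shortComplex_shortExact _ (fun x => ⟨fun hx => ⟨⟨x, congr(($hx).1)⟩, rfl⟩, ?_⟩)
    Subtype.val_injective ?_
  · rintro ⟨y, rfl⟩
    exact Subtype.ext y.2
  · rintro ⟨y, hy⟩
    obtain ⟨x, hx⟩ := (h y).1 hy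
    exact ⟨x, Subtype.ext hx⟩

theorem ModuleCat.isZero_ker {M N : ModuleCat.{u} A} (f : M ⟶ N) (hM : IsZero M) :
    IsZero (ModuleCat.of A (LinearMap.ker f.hom)) := by
  have := ModuleCat.subsingleton_of_isZero hM
  exact ModuleCat.isZero_of_subsingleton _

/-! ### Acyclicity of `Add T`, and generation by `T` -/

namespace IsClassicalTilting

variable {n : ℕ} {T : ModuleCat.{u} A}

theorem kerExtAbove_length (hT : IsClassicalTilting n T) (X : ModuleCat.{u} A) :
    kerExtAbove T n X := by
  obtain ⟨P, -, hP⟩ := hT.finite_projective_resolution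
  exact fun i hi => subsingleton_ext_of_isZero_resolution P X (hP i hi)

theorem kerExtAbove_zero_of_isSummandOfCoproduct (hT : IsClassicalTilting n T)
    {M : ModuleCat.{u} A} (hM : IsSummandOfCoproduct T M) : kerExtAbove T 0 M := by
  obtain ⟨P, hfin, -⟩ := hT.finite_projective_resolution
  intro i hi
  obtain ⟨i, rfl⟩ := Nat.exists_eq_add_one.2 hi
  have := hfin (i + 1)
  refine subsingleton_ext_of_isSummandOfCoproduct P i ?_ hM
  by_cases hin : i + 1 ≤ n
  · exact hT.rigid _ hi hin
  · exact hT.kerExtAbove_length T _ (not_le.1 hin)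

/-- Every module `X` with `Ext^i(T, X) = 0` for all `i > 0` is generated by `T`. -/
theorem exists_summand_hom_apply_eq (hT : IsClassicalTilting n T) {X : ModuleCat.{u} A}
    (hX : kerExtAbove T 0 X) (x : X) :
    ∃ (M : ModuleCat.{u} A) (_ : IsSummandOfCoproduct T M) (f : M →ₗ[A] X) (m : M), f m = x := by
  obtain ⟨C, ε, hε, hC, hC₀⟩ := hT.coresolution
  have hex : ∀ i, Function.Exact (C.d i (i + 1)).hom (C.d (i + 1) (i + 1 + 1)).hom := by
    intro i
    have h : C.ExactAt (i + 1) := (quasiIsoAt_iff_exactAt ε (i + 1)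
      (CochainComplex.exactAt_succ_single_obj _ _)).1 inferInstance
    rw [C.exactAt_iff' i (i + 1) (i + 1 + 1) (by simp) (by simp)] at h
    exact (ShortComplex.ShortExact.moduleCat_exact_iff_function_exact _).1 h
  -- Descending induction on `j`, starting beyond `n` where the cocycles `Z^j` vanish: `Ext^i(Z^j,
  -- X)` sits between `Ext^i(C^j, X) = 0` and `Ext^(i+1)(Z^(j+1), X)`.
  have hvan : ∀ k j i : ℕ, 0 < i → n < j + k →
      Subsingleton (Ext (ModuleCat.of A (LinearMap.ker (C.d j (j + 1)).hom)) X i) := by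
    intro k
    induction k with
    | zero =>
      intro j i _ hj
      exact subsingleton_ext_of_isZero_left (ModuleCat.isZero_ker _ (hC₀ j hj)) _ _
    | succ k ih =>
      intro j i hi hj
      have := (hC j).1
      exact subsingleton_ext_of_contravariant_left
        (kernelSequence_shortExact (C.d_comp_d j (j + 1) (j + 1 + 1)) (hex j)) X i
        (subsingleton_ext_of_finite_summand (hC j).2 X i (hX i hi))
        (ih (j + 1) (i + 1) i.succ_pos (by lia))
  have hz := (CochainComplex.quasiIsoAt₀_iff ε).1 inferInstance
  rw [ShortComplex.quasiIso_iff_of_zeros _ rfl rfl (C.shape 0 0 (by simp))] at hz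
  obtain ⟨h₀, hmono⟩ := hz
  let a : ModuleCat.of A A ⟶ C.X 0 := ε.f 0
  have ha : Function.Injective a := (ModuleCat.mono_iff_injective _).1 hmono
  have ha' : Function.Exact a.hom (C.d 0 1).hom :=
    (ShortComplex.ShortExact.moduleCat_exact_iff_function_exact _).1 h₀
  have hw : a ≫ C.d 0 1 = 0 := by
    refine ModuleCat.hom_ext (LinearMap.ext fun y => ?_)
    exact (ha' _).2 ⟨y, rfl⟩
  let S : ShortComplex (ModuleCat.{u} A) :=
    ShortComplex.mk (X₃ := ModuleCat.of A (LinearMap.ker (C.d 1 2).hom)) a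
      (kernelSequence (C.d 0 1) (C.d 1 2) (C.d_comp_d 0 1 2)).g
      (ModuleCat.hom_ext (LinearMap.ext fun y => Subtype.ext congr($(hw).hom y)))
  have hS : S.ShortExact := by
    refine ModuleCat.shortComplex_shortExact _ (fun y => ?_) ha
      (kernelSequence_shortExact (C.d_comp_d 0 1 2) (hex 0)).surjective_g
    exact Subtype.ext_iff.trans (ha' y)
  -- Since `Ext^1(Z^1, X) = 0`, the map `A → X` sending `1` to `x` extends along `A → T_0`, so `x`
  -- is in the image of `T_0`.
  obtain ⟨g, hg⟩ := exists_extension_of_subsingleton_ext hS X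
    (hvan n 1 1 one_pos (by lia)) (ModuleCat.ofHom (LinearMap.toSpanSingleton A X x))
  exact ⟨C.X 0, (hC 0).2, g.hom, a (1 : A), by simpa using congr($(hg).hom (1 : A))⟩

end IsClassicalTilting

/-- The coproduct of copies of `T` indexed by the homomorphisms from `T` to `X`. -/
noncomputable abbrev addCover (T X : ModuleCat.{u} A) : ModuleCat.{u} A := ModuleCat.of A ((T →ₗ[A] X) →₀ T)

/-- The evaluation homomorphism from `addCover T X` to `X`. -/
noncomputable def addCoverHom (T X : ModuleCat.{u} A) : addCover T X ⟶ X :=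
  ModuleCat.ofHom (Finsupp.lsum ℕ fun f => f)

theorem addCoverHom_single (T X : ModuleCat.{u} A) (f : T →ₗ[A] X) (t : T) :
    (addCoverHom T X).hom (Finsupp.single f t) = f t := by
  simp [addCoverHom]

/-- The kernel of the evaluation homomorphism. -/
noncomputable abbrev addSyzygy (T X : ModuleCat.{u} A) : ModuleCat.{u} A :=
  ModuleCat.of A (LinearMap.ker (addCoverHom T X).hom)

namespace IsClassicalTilting

variable {n : ℕ} {T : ModuleCat.{u} A}

/-- A map to `X` from a summand of `T^(ι)` extends to `T^(ι)` through the retraction, and its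
restriction to each copy of `T` is one of the maps indexing the cover. -/
theorem addCoverHom_surjective (hT : IsClassicalTilting n T) {X : ModuleCat.{u} A}
    (hX : kerExtAbove T 0 X) : Function.Surjective (addCoverHom T X).hom := by
  intro x
  obtain ⟨M, hM, f, m, rfl⟩ := hT.exists_summand_hom_apply_eq hX x
  obtain ⟨ι, s, r, hrs⟩ := hM.exists_retract
  have h : ∀ y : ι →₀ T, f (r y) ∈ LinearMap.range (addCoverHom T X).hom := by
    intro y
    induction y using Finsupp.induction_linear with
    | zero => simp
    | add y z hy hz => rw [map_add, map_add]; exact add_mem hy hz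
    | single i t => exact ⟨_, addCoverHom_single T X (f ∘ₗ r ∘ₗ Finsupp.lsingle i) t⟩
  have := h (s m)
  rwa [hrs] at this

theorem kerExtAbove_zero_addSyzygy (hT : IsClassicalTilting n T) {X : ModuleCat.{u} A}
    (hX : kerExtAbove T 0 X) : kerExtAbove T 0 (addSyzygy T X) := by
  have hS := LinearMap.shortExact_shortComplexKer (hT.addCoverHom_surjective hX)
  have hF := hT.kerExtAbove_zero_of_isSummandOfCoproduct
    (isSummandOfCoproduct_finsupp T (T →ₗ[A] X))
  intro i hi
  obtain ⟨i, rfl⟩ := Nat.exists_eq_add_one.2 hi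
  rcases i.eq_zero_or_pos with rfl | hi'
  -- A map `f : T → X` lifts to the inclusion of the copy of `T` indexed by `f`.
  · refine subsingleton_ext_one_left hS T (fun f => ⟨ModuleCat.ofHom (Finsupp.lsingle f.hom), ?_⟩)
      (hF 1 one_pos)
    ext t
    exact addCoverHom_single T X f.hom t
  · exact subsingleton_ext_left hS T i (hX i hi') (hF _ hi)

end IsClassicalTilting

/-! ### Coresolutions with acyclic first term -/

section Sequences

/-- The sequence of modules with first term `Y` followed by the sequence `M`. -/
def consObj (Y : ModuleCat.{u} A) (M : ℕ → ModuleCat.{u} A) : ℕ → ModuleCat.{u} A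
  | 0 => Y
  | i + 1 => M i

/-- The homomorphisms of the sequence `Y → M 0 → M 1 → ⋯`. -/
def consHom {Y : ModuleCat.{u} A} {M : ℕ → ModuleCat.{u} A} (f : Y ⟶ M 0)
    (d : ∀ i, M i ⟶ M (i + 1)) : ∀ i, consObj Y M i ⟶ consObj Y M (i + 1)
  | 0 => f
  | i + 1 => d i

/-- There is an exact sequence `0 → X → M 0 → M 1 → ⋯ → M e → 0` with `Ext^i(T, M 0) = 0` for
`i > 0` and `M i` in `Add T` for `i > 0`. -/
structure AddCoresolution (T : ModuleCat.{u} A) (e : ℕ) (X : ModuleCat.{u} A) where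
  /-- the terms -/
  M : ℕ → ModuleCat.{u} A
  /-- the differentials -/
  d : ∀ i, M i ⟶ M (i + 1)
  /-- the augmentation -/
  ι : X ⟶ M 0
  kerExtAbove_zero : kerExtAbove T 0 (M 0)
  isSummandOfCoproduct : ∀ i, IsSummandOfCoproduct T (M (i + 1))
  isZero : ∀ i, e < i → IsZero (M i)
  injective : Function.Injective ι.hom
  exact_zero : Function.Exact ι.hom (d 0).hom
  exact_succ : ∀ i, Function.Exact (d i).hom (d (i + 1)).hom

end Sequences

namespace IsClassicalTilting

variable {n : ℕ} {T : ModuleCat.{u} A}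

/-- Each inductive step turns the acyclic first term for `I/X` into a term of `Add T` by covering
it, and moves the defect into a new acyclic first term, the pullback of the cover to the injective
hull-type embedding `X → I`. -/
theorem nonempty_addCoresolution (hT : IsClassicalTilting n T) (e : ℕ) :
    ∀ X : ModuleCat.{u} A, kerExtAbove T e X → Nonempty (AddCoresolution T e X) := by
  induction e with
  | zero =>
    intro X hX
    have hz : IsZero (ModuleCat.of A PUnit.{u + 1}) := ModuleCat.isZero_of_subsingleton _
    exact ⟨{
      M := consObj X fun _ => ModuleCat.of A PUnit.{u + 1}
      d := consHom 0 fun _ => 0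
      ι := 𝟙 X
      kerExtAbove_zero := hX
      isSummandOfCoproduct := fun i => isSummandOfCoproduct_of_isZero T hz
      isZero := by
        rintro (_ | i) hi
        · exact absurd hi (lt_irrefl 0)
        · exact hz
      injective := fun x y h => h
      exact_zero := fun x => ⟨fun _ => ⟨x, rfl⟩, fun _ => rfl⟩
      exact_succ := fun i (x : PUnit) => ⟨fun _ => ⟨0, rfl⟩, fun _ => rfl⟩ }⟩
  | succ e ih =>
    intro X hX
    let I : ModuleCat.{u} A := Injective.under X
    let j : X ⟶ I := Injective.ι X
    have hj : Function.Injective j.hom := (ModuleCat.mono_iff_injective _).1 inferInstance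
    let N : Submodule A I := LinearMap.range j.hom
    let S : ShortComplex (ModuleCat.{u} A) :=
      ShortComplex.mk (X₃ := ModuleCat.of A (_ ⧸ N)) j (ModuleCat.ofHom N.mkQ)
        (by ext x; exact (Submodule.Quotient.mk_eq_zero N).2 ⟨x, rfl⟩)
    have hS : S.ShortExact := ModuleCat.shortComplex_shortExact _
      (fun y => Submodule.Quotient.mk_eq_zero N) hj N.mkQ_surjective
    obtain ⟨R⟩ := ih S.X₃ fun i hi => by
      obtain ⟨i, rfl⟩ := Nat.exists_eq_add_one.2 (Nat.zero_lt_of_lt hi)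
      exact subsingleton_ext_right hS T _ (Ext.subsingleton_of_injective _ _ _)
        (hX _ (by lia))
    let p := (addCoverHom T (R.M 0)).hom
    have hp : Function.Surjective p := hT.addCoverHom_surjective R.kerExtAbove_zero
    let q : I →ₗ[A] R.M 0 := R.ι.hom ∘ₗ N.mkQ
    -- The pullback of `I → I/X → M_0` and the evaluation `p`. Projection to `I` has kernel `Ker p`,
    -- which is acyclic; projection to the cover has kernel `X`.
    let Y : Submodule A (I × addCover T (R.M 0)) :=
      LinearMap.eqLocus (q ∘ₗ LinearMap.fst A _ _) (p ∘ₗ LinearMap.snd A _ _)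
    have hq : ∀ x, q (j.hom x) = 0 := fun x => by
      have : N.mkQ (j.hom x) = 0 := (Submodule.Quotient.mk_eq_zero N).2 ⟨x, rfl⟩
      simp only [q, LinearMap.comp_apply, this, map_zero]
    have hq' : ∀ y, q y = 0 → y ∈ N := fun y hy =>
      (Submodule.Quotient.mk_eq_zero N).1 (R.injective (hy.trans (map_zero R.ι.hom).symm))
    let S' : ShortComplex (ModuleCat.{u} A) :=
      ShortComplex.mk (X₁ := addSyzygy T (R.M 0)) (X₂ := ModuleCat.of A Y)
        (X₃ := I)
        (ModuleCat.ofHom ((LinearMap.inr A _ _ ∘ₗ Submodule.subtype _).codRestrict Y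
          fun t => show q 0 = p t by rw [map_zero]; exact (LinearMap.mem_ker.1 (Subtype.prop t)).symm))
        (ModuleCat.ofHom (LinearMap.fst A _ _ ∘ₗ Y.subtype)) (by ext; rfl)
    have hS' : S'.ShortExact := by
      refine ModuleCat.shortComplex_shortExact _ ?_ ?_ ?_
      · rintro ⟨⟨y, t⟩, h : q y = p t⟩
        constructor
        · rintro (rfl : y = 0)
          exact ⟨⟨t, h.symm.trans (map_zero q)⟩, rfl⟩
        · rintro ⟨s, hs⟩
          exact congr(($hs).1.1).symm
      · intro s t hst
        exact Subtype.ext congr(($hst).1.2)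
      · intro y
        obtain ⟨t, ht⟩ := hp (q y)
        exact ⟨⟨(y, t), ht.symm⟩, rfl⟩
    let f : ModuleCat.of A Y ⟶ addCover T (R.M 0) :=
      ModuleCat.ofHom (LinearMap.snd A _ _ ∘ₗ Y.subtype)
    exact ⟨{
      M := consObj (ModuleCat.of A Y) (consObj (addCover T (R.M 0)) fun i => R.M (i + 1))
      d := consHom f (consHom (addCoverHom T (R.M 0) ≫ R.d 0) fun i => R.d (i + 1))
      ι := ModuleCat.ofHom ((LinearMap.inl A _ _ ∘ₗ j.hom).codRestrict Y
        fun x => (hq x).trans (map_zero p).symm)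
      kerExtAbove_zero := fun i hi => by
        obtain ⟨i, rfl⟩ := Nat.exists_eq_add_one.2 hi
        exact subsingleton_ext_middle hS' T _
          (hT.kerExtAbove_zero_addSyzygy R.kerExtAbove_zero _ hi)
          (Ext.subsingleton_of_injective _ _ _)
      isSummandOfCoproduct := by
        rintro (_ | i)
        · exact isSummandOfCoproduct_finsupp T _
        · exact R.isSummandOfCoproduct i
      isZero := by
        rintro (_ | _ | i) hi
        · lia
        · lia
        · exact R.isZero (i + 1) (by lia)
      injective := fun x y h => hj congr(($h).1.1)
      exact_zero := by
        rintro ⟨⟨y, t⟩, h : q y = p t⟩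
        constructor
        · rintro (rfl : t = 0)
          obtain ⟨x, rfl⟩ := hq' y (h.trans (map_zero p))
          exact ⟨x, rfl⟩
        · rintro ⟨x, hx⟩
          exact congr(($hx).1.2).symm
      exact_succ := by
        rintro (_ | _ | i)
        · intro (t : addCover T (R.M 0))
          refine (R.exact_zero (p t)).trans ⟨?_, ?_⟩
          · rintro ⟨x, hx⟩
            obtain ⟨y, rfl⟩ := N.mkQ_surjective x
            exact ⟨⟨(y, t), hx⟩, rfl⟩
          · rintro ⟨⟨⟨y, s⟩, h : q y = p s⟩, rfl : s = t⟩
            exact ⟨N.mkQ y, h⟩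
        · intro (m : R.M 1)
          refine (R.exact_succ 0 m).trans ⟨?_, ?_⟩
          · rintro ⟨y, rfl⟩
            obtain ⟨t, rfl⟩ := hp y
            exact ⟨t, rfl⟩
          · rintro ⟨t, rfl⟩
            exact ⟨p t, rfl⟩
        · exact R.exact_succ (i + 1) }⟩

end IsClassicalTilting

/-! ### Splicing the coresolution with the resolution of its first term -/

/-- The homology of `X₁ → X₂ → X₃` is the kernel of the homomorphism to `X₃` from the cokernel of
`X₁ → X₂`. -/
theorem nonempty_homology_iso (S : ShortComplex (ModuleCat.{u} A)) {X Y : ModuleCat.{u} A}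
    {p : S.X₂ ⟶ Y} {q : Y ⟶ S.X₃} {ι : X ⟶ Y} (hpq : p ≫ q = S.g)
    (hp : Function.Surjective p.hom) (hfp : Function.Exact S.f.hom p.hom)
    (hι : Function.Injective ι.hom) (hιq : Function.Exact ι.hom q.hom) :
    Nonempty (S.homology ≅ X) := by
  have : Epi p := (ModuleCat.epi_iff_surjective _).2 hp
  have : Mono ι := (ModuleCat.mono_iff_injective _).2 hι
  have wp : S.f ≫ p = 0 := ModuleCat.hom_ext (LinearMap.ext fun x => (hfp _).2 ⟨x, rfl⟩)
  have wq : ι ≫ q = 0 := ModuleCat.hom_ext (LinearMap.ext fun x => (hιq _).2 ⟨x, rfl⟩)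
  have h₁ : (ShortComplex.mk S.f p wp).Exact := ModuleCat.shortComplex_exact _ hfp
  have h₂ : (ShortComplex.mk ι q wq).Exact := ModuleCat.shortComplex_exact _ hιq
  have hdesc : h₁.gIsCokernel.desc (CokernelCofork.ofπ _ S.zero) = q := by
    rw [← cancel_epi p, hpq]
    exact Cofork.IsColimit.π_desc h₁.gIsCokernel
  have wι : ι ≫ h₁.gIsCokernel.desc (CokernelCofork.ofπ _ S.zero) = 0 := hdesc ▸ wq
  have h₃ : (ShortComplex.mk ι _ wι).Exact := by
    simpa only [hdesc] using h₂
  exact ⟨ShortComplex.RightHomologyData.homologyIso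
    { Q := Y, H := X, p := p, ι := ι, wp := wp, hp := h₁.gIsCokernel, wι := wι,
      hι := h₃.fIsKernel }⟩

/-- In degree `0` the module `Y` is the cokernel of `d (-1)`, so the cohomology there is the kernel
`X` of the induced map `q`. -/
theorem hasAddComplex_of_sequence {T X Y : ModuleCat.{u} A} {e : ℕ} (M : ℤ → ModuleCat.{u} A)
    (d : ∀ i, M i ⟶ M (i + 1)) (hM : ∀ i, IsSummandOfCoproduct T (M i))
    (hM₀ : ∀ i : ℤ, (e : ℤ) < i → IsZero (M i)) (hd : ∀ i, d i ≫ d (i + 1) = 0)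
    (hex : ∀ i : ℤ, i + 1 ≠ 0 → Function.Exact (d i).hom (d (i + 1)).hom)
    {p : M 0 ⟶ Y} {q : Y ⟶ M 1} {ι : X ⟶ Y} (hpq : p ≫ q = d 0)
    (hp : Function.Surjective p.hom) (hfp : Function.Exact (d (-1)).hom p.hom)
    (hι : Function.Injective ι.hom) (hιq : Function.Exact ι.hom q.hom) :
    HasAddComplex T e X := by
  let K := CochainComplex.of M d hd
  have hK : ∀ i, K.d i (i + 1) = d i := fun i => CochainComplex.of_d M d i
  refine ⟨K, hM, hM₀, fun i hi => ?_, ?_⟩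
  · obtain ⟨i, rfl⟩ : ∃ j, i = j + 1 := ⟨i - 1, by ring⟩
    rw [K.exactAt_iff' i (i + 1) (i + 1 + 1) (by simp) (by simp)]
    refine ModuleCat.shortComplex_exact _ ?_
    change Function.Exact (K.d i (i + 1)).hom (K.d (i + 1) (i + 1 + 1)).hom
    rw [hK, hK]
    exact hex i hi
  · have h₀ : K.d 0 1 = d 0 := hK 0
    have h₁ : K.d (-1) 0 = d (-1) := hK (-1)
    obtain ⟨i⟩ := nonempty_homology_iso (K.sc' (-1) 0 1) (p := p) (q := q) (ι := ι)
      (hpq.trans h₀.symm) hp (by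
        change Function.Exact (K.d (-1) 0).hom p.hom
        rw [h₁]
        exact hfp) hι hιq
    exact ⟨K.homologyIsoSc' (-1) 0 1 (by simp) (by simp) ≪≫ i⟩

/-- The iterated kernels of the evaluation homomorphisms. -/
noncomputable def iteratedAddSyzygy (T Y : ModuleCat.{u} A) : ℕ → ModuleCat.{u} A
  | 0 => Y
  | k + 1 => addSyzygy T (iteratedAddSyzygy T Y k)

/-- The terms of the resolution of `Y` by coproducts of copies of `T`. -/
noncomputable def addResolutionObj (T Y : ModuleCat.{u} A) (k : ℕ) : ModuleCat.{u} A :=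
  addCover T (iteratedAddSyzygy T Y k)

/-- The differentials of the resolution of `Y` by coproducts of copies of `T`. -/
noncomputable def addResolutionHom (T Y : ModuleCat.{u} A) (k : ℕ) :
    addResolutionObj T Y (k + 1) ⟶ addResolutionObj T Y k :=
  addCoverHom T (iteratedAddSyzygy T Y (k + 1)) ≫
    ModuleCat.ofHom (LinearMap.ker (addCoverHom T (iteratedAddSyzygy T Y k)).hom).subtype

namespace IsClassicalTilting

variable {n : ℕ} {T : ModuleCat.{u} A}

theorem kerExtAbove_zero_iteratedAddSyzygy (hT : IsClassicalTilting n T) {Y : ModuleCat.{u} A}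
    (hY : kerExtAbove T 0 Y) : ∀ k, kerExtAbove T 0 (iteratedAddSyzygy T Y k)
  | 0 => hY
  | k + 1 => hT.kerExtAbove_zero_addSyzygy (hT.kerExtAbove_zero_iteratedAddSyzygy hY k)

theorem exact_addResolutionHom_addCoverHom (hT : IsClassicalTilting n T) {Y : ModuleCat.{u} A}
    (hY : kerExtAbove T 0 Y) (k : ℕ) : Function.Exact (addResolutionHom T Y k).hom
      (addCoverHom T (iteratedAddSyzygy T Y k)).hom := by
  intro x
  constructor
  · intro hx
    obtain ⟨y, hy⟩ := hT.addCoverHom_surjective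
      (hT.kerExtAbove_zero_iteratedAddSyzygy hY (k + 1)) ⟨x, hx⟩
    exact ⟨y, congr(($hy).1)⟩
  · rintro ⟨y, rfl⟩
    exact LinearMap.mem_ker.1 (Subtype.prop
      ((addCoverHom T (iteratedAddSyzygy T Y (k + 1))).hom y))

theorem exact_addResolutionHom (hT : IsClassicalTilting n T) {Y : ModuleCat.{u} A}
    (hY : kerExtAbove T 0 Y) (k : ℕ) : Function.Exact (addResolutionHom T Y (k + 1)).hom
      (addResolutionHom T Y k).hom := fun x =>
  Iff.trans ⟨fun h => Subtype.ext h, fun h => congrArg Subtype.val h⟩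
    (hT.exact_addResolutionHom_addCoverHom hY (k + 1) x)

end IsClassicalTilting

namespace AddCoresolution

variable {T X : ModuleCat.{u} A} {e : ℕ} (R : AddCoresolution T e X)

/-- The terms of the complex obtained by splicing a coresolution of `X` with the resolution of its
first term. -/
noncomputable def spliceObj : ℤ → ModuleCat.{u} A
  | .ofNat i => consObj (addResolutionObj T (R.M 0) 0) (fun i => R.M (i + 1)) i
  | .negSucc k => addResolutionObj T (R.M 0) (k + 1)

/-- The differentials of the spliced complex. -/
noncomputable def spliceHom : ∀ i : ℤ, R.spliceObj i ⟶ R.spliceObj (i + 1)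
  | .ofNat i => consHom (Y := addResolutionObj T (R.M 0) 0) (M := fun i => R.M (i + 1))
      (addCoverHom T (R.M 0) ≫ R.d 0) (fun i => R.d (i + 1)) i
  -- The target index `i + 1` reduces to `0` here and to `.negSucc k` in the next case, hence two
  -- patterns.
  | .negSucc 0 => addResolutionHom T (R.M 0) 0
  | .negSucc (k + 1) => addResolutionHom T (R.M 0) (k + 1)

variable {n : ℕ}

theorem exact_spliceHom (hT : IsClassicalTilting n T) :
    ∀ i : ℤ, i + 1 ≠ 0 → Function.Exact (R.spliceHom i).hom (R.spliceHom (i + 1)).hom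
  | .ofNat 0, _ => fun (x : R.M 1) => by
    refine (R.exact_succ 0 x).trans ⟨?_, ?_⟩
    · rintro ⟨y, rfl⟩
      obtain ⟨t, rfl⟩ := hT.addCoverHom_surjective R.kerExtAbove_zero y
      exact ⟨t, rfl⟩
    · rintro ⟨t, rfl⟩
      exact ⟨(addCoverHom T (R.M 0)).hom t, rfl⟩
  | .ofNat (i + 1), _ => R.exact_succ (i + 1)
  | .negSucc 0, h => absurd rfl h
  | .negSucc 1, _ => hT.exact_addResolutionHom R.kerExtAbove_zero 0
  | .negSucc (k + 2), _ => hT.exact_addResolutionHom R.kerExtAbove_zero (k + 1)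

theorem hasAddComplex (R : AddCoresolution T e X) (hT : IsClassicalTilting n T) : HasAddComplex T e X := by
  have h := hT.exact_addResolutionHom_addCoverHom R.kerExtAbove_zero 0
  refine hasAddComplex_of_sequence R.spliceObj R.spliceHom ?_ ?_ ?_ (R.exact_spliceHom hT)
    (p := addCoverHom T (R.M 0)) (q := R.d 0) (ι := R.ι) rfl
    (hT.addCoverHom_surjective R.kerExtAbove_zero) h R.injective R.exact_zero
  · rintro ((_ | i) | k)
    · exact isSummandOfCoproduct_finsupp T _
    · exact R.isSummandOfCoproduct i
    · exact isSummandOfCoproduct_finsupp T _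
  · rintro ((_ | i) | k) hi
    · exact absurd hi (not_lt.2 (Int.natCast_nonneg e))
    · exact R.isZero (i + 1) (by simpa using hi)
    · exact absurd (hi.trans (Int.negSucc_lt_zero k)) (not_lt.2 (Int.natCast_nonneg e))
  · intro i
    by_cases hi : i + 1 = 0
    -- At the splice the sequence is not exact; the composite vanishes because `d 0` factors through
    -- the evaluation onto `M_0`, which kills the image of `d (-1)`.
    · obtain rfl : i = -1 := by lia
      refine ModuleCat.hom_ext (LinearMap.ext fun x => ?_)
      exact (congrArg (R.d 0).hom ((h _).2 ⟨x, rfl⟩)).trans (map_zero _)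
    · exact ModuleCat.hom_ext (LinearMap.ext fun x => (R.exact_spliceHom hT i hi _).2 ⟨x, rfl⟩)

end AddCoresolution

/-! ### The converse: `Ext` vanishing from a complex -/

namespace IsClassicalTilting

variable {n : ℕ} {T : ModuleCat.{u} A}

theorem kerExtAbove_of_hasAddComplex (hT : IsClassicalTilting n T) {e : ℕ} {X : ModuleCat.{u} A}
    (hX : HasAddComplex T e X) : kerExtAbove T e X := by
  obtain ⟨K, hK, hK₀, hex, ⟨iso⟩⟩ := hX
  have hKT : ∀ j, kerExtAbove T 0 (K.X j) := fun j =>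
    hT.kerExtAbove_zero_of_isSummandOfCoproduct (hK j)
  have hS : ∀ j : ℤ, j + 1 ≠ 0 → (kernelSequence (K.d j (j + 1)) (K.d (j + 1) (j + 1 + 1))
      (K.d_comp_d _ _ _)).ShortExact := by
    intro j hj
    refine kernelSequence_shortExact _ ?_
    have h := hex (j + 1) hj
    rw [K.exactAt_iff' j (j + 1) (j + 1 + 1) (by simp) (by simp)] at h
    exact (ShortComplex.ShortExact.moduleCat_exact_iff_function_exact _).1 h
  -- Shift to the right: `Ext^(i+1)(T, Z^j)` is controlled by `Ext^i(T, Z^(j+1))`. Starting at `i =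
  -- 0` works because `Z^j` itself vanishes for `j > e`.
  have hpos : ∀ i j : ℕ, e < i + j → Subsingleton
      (Ext T (ModuleCat.of A (LinearMap.ker (K.d (j : ℤ) ((j : ℤ) + 1)).hom)) i) := by
    intro i
    induction i with
    | zero =>
      intro j hj
      exact subsingleton_ext_of_isZero_right (ModuleCat.isZero_ker _ (hK₀ j (by lia))) _ _
    | succ i ih =>
      intro j hj
      refine subsingleton_ext_left (hS j (by lia)) T i ?_ (hKT j _ i.succ_pos)
      have := ih (j + 1) (by lia)
      push_cast at this
      exact this
  -- Shift to the left: `Ext^i(T, Z^(j+1))` embeds in `Ext^(i+1)(T, Z^j)`. The complex may be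
  -- unbounded on this side, so the induction ends when the degree of `Ext` exceeds `n`; `k` counts
  -- the shifts left.
  have hneg : ∀ (k i : ℕ) (j : ℤ), j < 0 → n < i + k → 0 < i → Subsingleton
      (Ext T (ModuleCat.of A (LinearMap.ker (K.d j (j + 1)).hom)) i) := by
    intro k
    induction k with
    | zero => exact fun i j _ hi _ => hT.kerExtAbove_length _ i hi
    | succ k ih =>
      intro i j hj hi hi₀
      obtain ⟨j, rfl⟩ : ∃ j', j = j' + 1 := ⟨j - 1, by ring⟩
      exact subsingleton_ext_right (hS j (by lia)) T i (hKT j i hi₀)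
        (ih (i + 1) j (by lia) (by lia) i.succ_pos)
  intro i hi
  have hi₀ : 0 < i := Nat.zero_lt_of_lt hi
  let S := K.sc' (-1) 0 1
  let B := LinearMap.range S.moduleCatToCycles
  refine subsingleton_ext_of_iso (Y := ModuleCat.of A (LinearMap.ker S.g.hom ⧸ B))
    (S.moduleCatHomologyIso.symm ≪≫ (K.homologyIsoSc' (-1) 0 1 (by simp) (by simp)).symm ≪≫ iso)
    T i ?_
  -- The coboundaries `B` in degree `0` are the quotient of `K^(-1)` by `Z^(-1)`. With `X ≅ Z^0 /
  -- B`, vanishing of `Ext^i(T, Z^0)` and `Ext^(i+1)(T, B)` suffices.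
  have hB : Subsingleton (Ext T (ModuleCat.of A B) (i + 1)) := by
    refine subsingleton_ext_right
      (LinearMap.shortExact_shortComplexKer S.moduleCatToCycles.surjective_rangeRestrict) T (i + 1)
      (hKT (-1) _ i.succ_pos) ?_
    have hker : LinearMap.ker S.moduleCatToCycles.rangeRestrict =
        LinearMap.ker (K.d (-1) (-1 + 1)).hom := by
      rw [LinearMap.ker_rangeRestrict]
      ext x
      exact Subtype.ext_iff
    have h := hneg n (i + 2) (-1) (by lia) (by lia) (by lia)
    rw [← hker] at h
    exact h
  let S' : ShortComplex (ModuleCat.{u} A) :=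
    ShortComplex.mk (X₃ := ModuleCat.of A (LinearMap.ker S.g.hom ⧸ B)) (ModuleCat.ofHom B.subtype)
      (ModuleCat.ofHom B.mkQ)
      (ModuleCat.hom_ext (LinearMap.ext fun x => (Submodule.Quotient.mk_eq_zero B).2 x.2))
  have hS' : S'.ShortExact := by
    refine ModuleCat.shortComplex_shortExact _ (fun x => ?_) B.subtype_injective B.mkQ_surjective
    exact (Submodule.Quotient.mk_eq_zero B).trans ⟨fun h => ⟨⟨x, h⟩, rfl⟩, fun ⟨y, hy⟩ => hy ▸ y.2⟩
  exact subsingleton_ext_right hS' T i (hpos i 0 (by simpa using hi)) hB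

end IsClassicalTilting

/-! ### Comparison with the shifted aisle in the derived category -/

theorem kerExtAbove_eq_inverseImage [HasDerivedCategory.{w} (ModuleCat.{u} A)]
    (T : ModuleCat.{u} A) (e : ℕ) :
    kerExtAbove T e = (tiltingAisleLE T (e : ℤ)).inverseImage
      (DerivedCategory.singleFunctor (ModuleCat.{u} A) 0) := by
  ext X
  let F := DerivedCategory.singleFunctor (ModuleCat.{u} A) 0
  -- `Ext^(e+j)(T, X)` is `Hom(T, X[e][j])`, so the degrees `i > e` correspond to the shifts `j >
  -- 0`.
  have key : ∀ i j : ℕ, i = e + j →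
      (Subsingleton (Ext T X i) ↔ ∀ f : F.obj T ⟶ (F.obj X)⟦(e : ℤ)⟧⟦(j : ℤ)⟧, f = 0) := by
    intro i j hij
    have σ : (F.obj X)⟦(e : ℤ)⟧⟦(j : ℤ)⟧ ≅ (F.obj X)⟦(i : ℤ)⟧ :=
      ((shiftFunctorAdd' _ (e : ℤ) (j : ℤ) (i : ℤ) (by lia)).app (F.obj X)).symm
    rw [Ext.homEquiv.subsingleton_congr]
    constructor
    · intro h f
      rw [← cancel_mono σ.hom]
      exact h.elim _ _
    · intro h
      refine ⟨fun a b => ?_⟩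
      rw [← cancel_mono σ.inv]
      exact (h _).trans (h _).symm
  constructor
  · intro h i hi
    obtain ⟨j, rfl⟩ := Int.eq_ofNat_of_zero_le hi.le
    exact (key (e + j) j rfl).1 (h _ (by lia))
  · intro h i hi
    obtain ⟨j, rfl⟩ := Nat.exists_eq_add_of_lt hi
    exact (key _ (j + 1) rfl).2 (h _ (by lia))

end Modules

theorem mainTheorem1 {A : Type u} [Ring A] [HasDerivedCategory.{w} (ModuleCat.{u} A)]
    (n : ℕ) (T : ModuleCat.{u} A) (hT : IsClassicalTilting n T) (e : ℕ) (he : e ≤ n) :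
    (∀ X : ModuleCat.{u} A, kerExtAbove T e X → HasAddComplex T e X) ∧
    (∀ X : ModuleCat.{u} A, HasAddComplex T e X → kerExtAbove T e X) ∧
    (∀ X : ModuleCat.{u} A, kerExtAbove T n X ∧ HasAddComplex T n X) ∧
    kerExtAbove T e =
      (tiltingAisleLE T (e : ℤ)).inverseImage
        (DerivedCategory.singleFunctor (ModuleCat.{u} A) 0) := by

  have h : ∀ (e : ℕ) (X : ModuleCat.{u} A), kerExtAbove T e X → HasAddComplex T e X :=
    fun e X hX => (hT.nonempty_addCoresolution e X hX).elim fun R => R.hasAddComplex hT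
  exact ⟨h e, fun X => hT.kerExtAbove_of_hasAddComplex,
    fun X => ⟨hT.kerExtAbove_length X, h n X (hT.kerExtAbove_length X)⟩,
    kerExtAbove_eq_inverseImage T e⟩
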